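/- Throughout, $r,s\ge 0$ and $x,y\ge 1$ are integers. **Definitions.** The Carlitz–Scoville generalised Eulerian numbers $A(r,s\,|\,x,y)$ are defined by $$\sum_{r,s\ge 0} A(r,s\,|\,x,y)\,\frac{u^r v^s}{(r+s)!}=(1+uF(u,v))^{x}\,(1+vF(u,v))^{y},\qquad F(u,v)=\frac{e^u-e^v}{u e^v-v e^u}.$$ A configuration is a tuple $c=(c_1,\dots,c_n)$ of nonnegative integers with $\sum_i c_i=n$; it represents $n$ balls, $c_i$ of them at site $i$. It is connected if its nonzero entries occupy a nonempty set of consecutive sites. For real $q\ge 0$, drop the $n$ balls one after the other onto the initially empty line $\mathbb Z$, each at its own site; while the ball being dropped is at an occupied site, it moves one site to the left with probability $q/(1+q)$ and one site to the right with probability $1/(1+q)$, and it stops at the first empty site that it reaches. Let $\mathbb P(c\to[1;n])_q$ be the probability that the final set of occupied sites is $\{1,\dots,n\}$, the balls being dropped from left to right. The remixed Eulerian number is $A_c(q)=[n]!\;\mathbb P(c\to[1;n])_q$, where $[n]!=\prod_{i=1}^n(1+q+\dots+q^{i-1})$; $A_c(1)$ is the mixed Eulerian number. For a partition $\lambda=(\lambda_1\ge\dots\ge\lambda_n\ge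 0)$ with $\lambda_1\le n$, the Garsia–Remmel $q$-hit numbers $H_i(\lambda,q)$ are defined by $$\sum_{i=0}^n H_i(\lambda,q)\,t^i=\sum_{k=0}^n R_{n-k}(\lambda^c,q)\,[k]!\,t^k\prod_{i=k+1}^n(1-tq^i),$$ where $\lambda^c$ is the Ferrers board whose columns, from left to right, stand on a common bottom row and have heights $n-\lambda_1\le\dots\le n-\lambda_n$, and $R_k(\lambda^c,q)=\sum_P q^{\mathrm{inv}(P)}$ is the $q$-rook number: $P$ runs over the placements of $k$ non-attacking rooks on $\lambda^c$, and $\mathrm{inv}(P)$ is the number of cells of $\lambda^c$ that contain no rook and lie neither to the right of a rook in its row nor below a rook in its column. **Theorem.** Let $c=(0^r,1^{y-1},r+s+1,1^{x-1},0^s)$ and $n=r+s+x+y-1$. Then $c$ is a connected configuration on $n$ sites; for $q=1$, the probability that the final set of occupied sites is $\{1,\dots,n\}$ is the same for every order in which the balls of $c$ are dropped; and $$A(r,s\,|\,x,y)=\frac{1}{(x+y-1)!}\,A_{(0^r,1^{y-1},r+s+1,1^{x-1},0^s)}(1).$$ Moreover, these numbers are specialisations of Garsia–Remmel hit numbers: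 with the partition $\lambda=(\lambda_1\ge\dots\ge\lambda_n)$, $\lambda_i=\min\bigl(r+s,\ \max(0,\,r+s+x-i)\bigr)$, whose parts are at most $n$, one has $$A(r,s\,|\,x,y)=\frac{1}{(x+y-1)!}\,H_r(\lambda,1).$$ -/

import Mathlib

open scoped NNReal ENNReal Nat

noncomputable section

/-! ## `q`-integers -/

/-- The `q`-integer `[i] = 1 + q + ⋯ + q ^ (i - 1)`. -/
def qInt (q : ℝ) (i : ℕ) : ℝ := ∑ k ∈ Finset.range i, q ^ k

/-- The `q`-factorial `[n]! = [1] [2] ⋯ [n]`. -/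
def qFactorial (q : ℝ) (n : ℕ) : ℝ := ∏ i ∈ Finset.Icc 1 n, qInt q i

/-! ## The particle model and remixed Eulerian numbers -/

/-- The coin deciding the direction of a move: `true` (left) has probability `q / (1 + q)` and
`false` (right) has probability `1 / (1 + q)`. -/
def moveCoin (q : ℝ≥0) : PMF Bool :=
  PMF.ofFintype (fun b => ((cond b (q / (1 + q)) (1 / (1 + q)) : ℝ≥0) : ℝ≥0∞)) (by
    have h : (1 + q : ℝ≥0) ≠ 0 := by positivity
    rw [Fintype.sum_bool, ← ENNReal.coe_add]
    simp only [cond_true, cond_false]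
    rw [← add_div, add_comm q 1, div_self h]
    rfl)

/-- A state of the dynamics on the sites `ℤ`: the finite set of occupied sites, and the list of
the balls that have not stopped yet. The head of the list is the current position of the ball
that is being dropped; the tail lists the starting sites of the later balls, in order. -/
abbrev DropState : Type := Finset ℤ × List ℤ

/-- One step of the dynamics. If the current ball is at an occupied site, it moves one site left
with probability `q / (1 + q)` and one site right with probability `1 / (1 + q)`. If it is at an
empty site, it stops there, and the next ball is dropped. Nothing happens once all balls have
stopped. -/
def dropStep (q : ℝ≥0) : DropState → PMF DropState
  | (S, []) => PMF.pure (S, [])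
  | (S, u :: us) =>
      if u ∈ S then
        (moveCoin q).bind fun left =>
          PMF.pure (S, (if left then u - 1 else u + 1) :: us)
      else PMF.pure (insert u S, us)

/-- The law of the state after `k` steps. -/
def dropLaw (q : ℝ≥0) : ℕ → DropState → PMF DropState
  | 0, st => PMF.pure st
  | k + 1, st => (dropStep q st).bind (dropLaw q k)

/-- The probability that the final support is `T` when balls are dropped onto the empty line `ℤ`
from the sites `u₁, …, uₙ`, in this order. Final states are absorbing, so that the supremum is
the increasing limit of the probabilities of being finished, with support `T`, after `k` steps. -/
def finalSupportProb (q : ℝ≥0) (u : List ℤ) (T : Finset ℤ) : ℝ≥0∞ :=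
  ⨆ k : ℕ, dropLaw q k (∅, u) (T, [])

/-- A configuration: a tuple `(c₁, …, cₙ)` of natural numbers with sum `n`. -/
def IsConfiguration (c : List ℕ) : Prop := c.sum = c.length

/-- A configuration is connected if it has the form `(0^k, γ, 0^l)` with `γ` nonempty and all
entries of `γ` positive. -/
def IsConnectedConfiguration (c : List ℕ) : Prop :=
  IsConfiguration c ∧ ∃ (k l : ℕ) (γ : List ℕ), γ ≠ [] ∧ (∀ g ∈ γ, 0 < g) ∧
    c = List.replicate k 0 ++ γ ++ List.replicate l 0

/-- The multiset of balls of `c`: it contains each site `i ∈ {1, …, n}` exactly `cᵢ` times. -/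
def ballMultiset (c : List ℕ) : Multiset ℤ :=
  ∑ i : Fin c.length, Multiset.replicate (c.get i) ((i : ℤ) + 1)

/-- `u` is an order of content `c`. -/
def HasContent (u : List ℤ) (c : List ℕ) : Prop := (u : Multiset ℤ) = ballMultiset c

/-- The left-to-right order of `c`: the non-decreasing sequence of content `c`. -/
def leftToRightOrder (c : List ℕ) : List ℤ := (ballMultiset c).sort (· ≤ ·)

/-- The remixed Eulerian number `A_c(q) = [n]! · ℙ(c → {1, …, n})_q`, the balls being dropped in
the left-to-right order. The number `A_c(1)` is the mixed Eulerian number. -/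
def remixedEulerian (q : ℝ≥0) (c : List ℕ) : ℝ :=
  qFactorial q c.length *
    (finalSupportProb q (leftToRightOrder c) (Finset.Icc 1 (c.length : ℤ))).toReal

/-- The tuple `(0^r, 1^{y-1}, r+s+1, 1^{x-1}, 0^s)`. -/
def csConfiguration (r s x y : ℕ) : List ℕ :=
  List.replicate r 0 ++ List.replicate (y - 1) 1 ++ [r + s + 1] ++
    List.replicate (x - 1) 1 ++ List.replicate s 0

/-! ## Carlitz–Scoville generalised Eulerian numbers -/

/-- The exponential `e^{Xᵢ}` in `ℝ⟦X₀, X₁⟧`. -/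
def expX (i : Fin 2) : MvPowerSeries (Fin 2) ℝ := fun m =>
  if m = Finsupp.single i (m i) then 1 / ((m i)! : ℝ) else 0

/-- The series `∑ X₀^a X₁^b / (a + b + k)!`. -/
def csSeries (k : ℕ) : MvPowerSeries (Fin 2) ℝ := fun m => 1 / ((m 0 + m 1 + k)! : ℝ)

/-- `∑ X₀^a X₁^b / (a + b + 1)!`, which is `(e^{X₀} - e^{X₁}) / (X₀ - X₁)`. -/
def csNum : MvPowerSeries (Fin 2) ℝ := csSeries 1

/-- `1 - X₀ X₁ ∑ X₀^a X₁^b / (a + b + 2)!`, which is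
`(X₀ e^{X₁} - X₁ e^{X₀}) / (X₀ - X₁)`. -/
def csDen : MvPowerSeries (Fin 2) ℝ :=
  1 - MvPowerSeries.X 0 * MvPowerSeries.X 1 * csSeries 2

/-- The formal power series `F(X₀, X₁) = (e^{X₀} - e^{X₁}) / (X₀ e^{X₁} - X₁ e^{X₀})`; see
`csF_mul` for the defining identity. -/
def csF : MvPowerSeries (Fin 2) ℝ := csNum * csDen⁻¹

/-- `∑ Xᵢ^j / (j + k)!`, an auxiliary series for `csF_mul`. -/
def expTail (k : ℕ) (i : Fin 2) : MvPowerSeries (Fin 2) ℝ := fun m =>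
  if m = Finsupp.single i (m i) then 1 / ((m i + k)! : ℝ) else 0

theorem coeff_X_mul_csAux (i : Fin 2) (f : MvPowerSeries (Fin 2) ℝ) (m : Fin 2 →₀ ℕ) :
    MvPowerSeries.coeff m (MvPowerSeries.X i * f) =
      if m i = 0 then 0 else f (m - Finsupp.single i 1) := by
  rw [MvPowerSeries.X, MvPowerSeries.coeff_monomial_mul]
  simp only [Finsupp.single_le_iff, one_mul]
  by_cases h : m i = 0
  · simp [h]
  · rw [if_pos (Nat.one_le_iff_ne_zero.mpr h), if_neg h]
    rfl

theorem eq_single_zero_iff_csAux (m : Fin 2 →₀ ℕ) :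
    m = Finsupp.single 0 (m 0) ↔ m 1 = 0 := by
  constructor
  · intro h
    rw [h]
    simp
  · intro h
    ext i
    fin_cases i <;> simp [h]

theorem eq_single_one_iff_csAux (m : Fin 2 →₀ ℕ) :
    m = Finsupp.single 1 (m 1) ↔ m 0 = 0 := by
  constructor
  · intro h
    rw [h]
    simp
  · intro h
    ext i
    fin_cases i <;> simp [h]

theorem sub_mul_csAux (k : ℕ) :
    (MvPowerSeries.X 0 - MvPowerSeries.X 1) * csSeries (k + 1) =
      expTail k 0 - expTail k 1 := by
  ext m
  rw [sub_mul, map_sub, map_sub, coeff_X_mul_csAux, coeff_X_mul_csAux]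
  change _ = expTail k 0 m - expTail k 1 m
  simp only [csSeries, expTail, eq_single_zero_iff_csAux, eq_single_one_iff_csAux]
  rcases h0 : m 0 with _ | a <;> rcases h1 : m 1 with _ | b
  · simp
  · simp [h0, h1, add_comm, add_left_comm]
  · simp [h0, h1, add_comm, add_left_comm]
  · simp [h0, h1, add_comm, add_left_comm]

theorem expX_eq_csAux (i : Fin 2) : expX i = 1 + MvPowerSeries.X i * expTail 1 i := by
  ext m
  rw [map_add, coeff_X_mul_csAux, MvPowerSeries.coeff_one]
  change expX i m = _
  fin_cases i
  · simp only [expX, expTail, Fin.zero_eta, eq_single_zero_iff_csAux]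
    rcases h0 : m 0 with _ | a <;> by_cases h1 : m 1 = 0
    · have : m = 0 := by ext i; fin_cases i <;> simp [h0, h1]
      simp [this]
    · have : m ≠ 0 := by rintro rfl; simp at h1
      simp [h1, this]
    · have : m ≠ 0 := by rintro rfl; simp at h0
      simp [h0, h1, this]
    · have : m ≠ 0 := by rintro rfl; simp at h0
      simp [h1, this]
  · simp only [expX, expTail, Fin.mk_one, eq_single_one_iff_csAux]
    rcases h0 : m 1 with _ | a <;> by_cases h1 : m 0 = 0
    · have : m = 0 := by ext i; fin_cases i <;> simp [h0, h1]
      simp [this]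
    · have : m ≠ 0 := by rintro rfl; simp at h1
      simp [h1, this]
    · have : m ≠ 0 := by rintro rfl; simp at h0
      simp [h0, h1, this]
    · have : m ≠ 0 := by rintro rfl; simp at h0
      simp [h1, this]

/-- The defining identity of `F`. -/
theorem csF_mul :
    csF * (MvPowerSeries.X 0 * expX 1 - MvPowerSeries.X 1 * expX 0) = expX 0 - expX 1 := by
  have hc : MvPowerSeries.constantCoeff csDen ≠ 0 := by simp [csDen]
  have hN : (MvPowerSeries.X 0 - MvPowerSeries.X 1) * csNum = expX 0 - expX 1 := sub_mul_csAux 0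
  have hD : (MvPowerSeries.X 0 - MvPowerSeries.X 1) * csDen =
      MvPowerSeries.X 0 * expX 1 - MvPowerSeries.X 1 * expX 0 := by
    rw [csDen, expX_eq_csAux 0, expX_eq_csAux 1]
    linear_combination -(MvPowerSeries.X 0 * MvPowerSeries.X 1) * sub_mul_csAux 1
  rw [← hD, ← hN, csF]
  linear_combination ((MvPowerSeries.X 0 - MvPowerSeries.X 1) * csNum) *
    MvPowerSeries.inv_mul_cancel csDen hc

/-- The Carlitz–Scoville generalised Eulerian number `A(r,s|α,β)`, defined by
`∑ A(r,s|α,β) X₀^r X₁^s / (r + s)! = (1 + X₀ F(X₀, X₁))^α (1 + X₁ F(X₀, X₁))^β`. -/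
def carlitzScoville (r s α β : ℕ) : ℝ :=
  ((r + s)! : ℝ) *
    MvPowerSeries.coeff (Finsupp.single 0 r + Finsupp.single 1 s)
      ((1 + MvPowerSeries.X 0 * csF) ^ α * (1 + MvPowerSeries.X 1 * csF) ^ β)

/-! ## Garsia–Remmel hit numbers

A partition `λ₁ ≥ ⋯ ≥ λₙ ≥ 0` with `λ₁ ≤ n` is a function `lam : Fin n → ℕ`. Cells are pairs
(column, row), numbered from `0`, columns from left to right and rows from bottom to top. -/

/-- The Ferrers board in the `n × n` square whose columns have the heights
`n - λ₁ ≤ ⋯ ≤ n - λₙ`: the complement of the diagram of `λ` (reflected vertically, so that the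
columns stand on the bottom row). -/
def complementBoard {n : ℕ} (lam : Fin n → ℕ) : Finset (Fin n × Fin n) :=
  Finset.univ.filter fun c => (c.2 : ℕ) < n - lam c.1

/-- The placements of `k` non-attacking rooks on the board `B`. -/
def rookPlacements {n : ℕ} (B : Finset (Fin n × Fin n)) (k : ℕ) :
    Finset (Finset (Fin n × Fin n)) :=
  (B.powersetCard k).filter fun P => ∀ a ∈ P, ∀ b ∈ P, a ≠ b → a.1 ≠ b.1 ∧ a.2 ≠ b.2

/-- The Garsia–Remmel statistic: each rook cancels its own cell, the cells to its right in its
row and the cells below it in its column; count the cells of `B` that are not cancelled. -/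
def rookInv {n : ℕ} (B P : Finset (Fin n × Fin n)) : ℕ :=
  (B.filter fun c =>
    ∀ a ∈ P, ¬ (a.2 = c.2 ∧ a.1 ≤ c.1) ∧ ¬ (a.1 = c.1 ∧ c.2 ≤ a.2)).card

/-- The `q`-rook number `R_k(B, q)`. -/
def qRook {n : ℕ} (q : ℝ) (B : Finset (Fin n × Fin n)) (k : ℕ) : ℝ :=
  ∑ P ∈ rookPlacements B k, q ^ rookInv B P

open Polynomial in
/-- The Garsia–Remmel `q`-hit polynomial
`∑ᵢ H_i(λ,q) t^i = ∑ₖ R_{n-k}(q) [k]! t^k (1 - t q^{k+1}) ⋯ (1 - t q^n)`,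
with the `q`-rook numbers of the complement of `λ` in the `n × n` square. For `q = 1`, `H_i` is
the number of permutations of `n` with exactly `i` hits on the diagram of `λ`. -/
def qHitPolynomial {n : ℕ} (q : ℝ) (lam : Fin n → ℕ) : ℝ[X] :=
  ∑ k ∈ Finset.range (n + 1),
    C (qRook q (complementBoard lam) (n - k) * qFactorial q k) * X ^ k *
      ∏ i ∈ Finset.Icc (k + 1) n, (1 - C (q ^ i) * X)

/-- The Garsia–Remmel `q`-hit number `H_i(λ, q)`. -/
def qHit {n : ℕ} (q : ℝ) (lam : Fin n → ℕ) (i : ℕ) : ℝ := (qHitPolynomial q lam).coeff i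

end

noncomputable section

/-! ## The dropping process for the symmetric walk -/

/-! Both formulas rest on the recurrence A(r,s|x,y) = x A(r-1,s|x,y+1) + y A(r,s-1|x+1,y), with
A(0,0|x,y) = 1 and terms of negative index omitted. It is read off from ϑ(1 + XᵢF) = Xᵢ(1 + X₀F)(1 +
X₁F), where the Euler operator ϑ multiplies a coefficient by its total degree
(`eulerOp_one_add_X_mul_csF`, `carlitzScoville_rec`).

Particles: for the symmetric walk, the probability of a given final support is, as a function of the
starting site of the next ball, harmonic on the occupied sites, hence determined by its values off
them. This gives independence of the order (`supportProb_perm`). So x + y - 1 balls on distinct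
sites may be dropped first; they fill an interval. The other r + s balls all start from one site, at
distance y from the empty site on the left and x from the one on the right, so by gambler's ruin the
interval grows to the left with probability x/(x+y) and to the right with probability y/(x+y). Up to
factorials this is the recurrence (`supportProb_replicate`).

Hits: at q = 1 the hit polynomial is (1 - t)^(n+1) ∑ P(z) t^z, with P the factorial rook polynomial
of the complement, which factors over the columns of a Ferrers board
(`coe_qHitPolynomial_one_eq_prod`). For the partition in question P(z) = (x+y-1)! (z+y)^(r+s)
C(z+x+y-1, x+y-1), and the coefficients of the resulting series obey the same recurrence
(`eulerCoeff_succ`). -/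

theorem dropLaw_mono (q : ℝ≥0) (T : Finset ℤ) (st : DropState) :
    Monotone fun k => dropLaw q k st (T, []) := by
  refine monotone_nat_of_le_succ fun k => ?_
  induction k generalizing st with
  | zero =>
    by_cases h : st = (T, [])
    · subst h
      simp [dropLaw, dropStep]
    · simp [dropLaw, PMF.pure_apply, Ne.symm h]
  | succ k ih =>
    change ((dropStep q st).bind (dropLaw q k)) (T, []) ≤
      ((dropStep q st).bind (dropLaw q (k + 1))) (T, [])
    simp only [PMF.bind_apply]
    exact ENNReal.tsum_le_tsum fun a => mul_le_mul_right (ih a) _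

/-- Dropping the first term of an increasing sequence keeps its supremum; this turns the first-step
decomposition of `dropLaw` into equations for the limit. -/
theorem iSup_dropLaw_succ (q : ℝ≥0) (T : Finset ℤ) (st : DropState) :
    ⨆ k, dropLaw q (k + 1) st (T, []) = ⨆ k, dropLaw q k st (T, []) :=
  (dropLaw_mono q T st).iSup_nat_add 1

/-- The probability that the final support is `T` when the balls `us` are dropped, by the
symmetric walk, with `S` already occupied. -/
def supportProb (T S : Finset ℤ) (us : List ℤ) : ℝ :=
  (⨆ k : ℕ, dropLaw 1 k (S, us) (T, [])).toReal

theorem iSup_dropLaw_ne_top (q : ℝ≥0) (T : Finset ℤ) (st : DropState) :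
    ⨆ k : ℕ, dropLaw q k st (T, []) ≠ ∞ :=
  ne_top_of_le_ne_top ENNReal.one_ne_top (iSup_le fun _ => PMF.coe_le_one _ _)

theorem supportProb_nil (T S : Finset ℤ) : supportProb T S [] = if S = T then 1 else 0 := by
  have h : ∀ k, dropLaw 1 k (S, []) = PMF.pure (S, []) := by
    intro k
    induction k with
    | zero => rfl
    | succ k ih => simp [dropLaw, dropStep, ih]
  simp only [supportProb, h, PMF.pure_apply, iSup_const, Prod.mk.injEq, and_true]
  by_cases hS : S = T
  · simp [hS]
  · simp [hS, Ne.symm hS]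

theorem supportProb_cons_of_notMem (T : Finset ℤ) {S : Finset ℤ} {u : ℤ} (us : List ℤ)
    (hu : u ∉ S) : supportProb T S (u :: us) = supportProb T (insert u S) us := by
  rw [supportProb, ← iSup_dropLaw_succ]
  simp [supportProb, dropLaw, dropStep, hu]

/-- First-step analysis. The limit passes through the sum because both summands increase with the
number of steps. -/
theorem supportProb_cons_of_mem (T : Finset ℤ) {S : Finset ℤ} {u : ℤ} (us : List ℤ)
    (hu : u ∈ S) : supportProb T S (u :: us) =
      (supportProb T S ((u - 1) :: us) + supportProb T S ((u + 1) :: us)) / 2 := by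
  have key : ∀ k, dropLaw 1 (k + 1) (S, u :: us) (T, []) =
      2⁻¹ * dropLaw 1 k (S, (u - 1) :: us) (T, []) +
        2⁻¹ * dropLaw 1 k (S, (u + 1) :: us) (T, []) := by
    intro k
    simp only [dropLaw, dropStep, hu, if_true, PMF.bind_bind, PMF.pure_bind]
    rw [PMF.bind_apply, tsum_fintype, Fintype.sum_bool]
    simp [moveCoin, one_add_one_eq_two]
  rw [supportProb, ← iSup_dropLaw_succ]
  simp only [key]
  rw [← ENNReal.iSup_add_iSup_of_monotone, ← ENNReal.mul_iSup, ← ENNReal.mul_iSup,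
    ENNReal.toReal_add, ENNReal.toReal_mul, ENNReal.toReal_mul]
  · simp only [supportProb, ENNReal.toReal_inv, ENNReal.toReal_ofNat]
    ring
  · exact ENNReal.mul_ne_top (by simp) (iSup_dropLaw_ne_top _ _ _)
  · exact ENNReal.mul_ne_top (by simp) (iSup_dropLaw_ne_top _ _ _)
  · exact fun a b hab => mul_le_mul_right (dropLaw_mono 1 T _ hab) _
  · exact fun a b hab => mul_le_mul_right (dropLaw_mono 1 T _ hab) _

/-! ### Harmonic functions on a finite set of sites -/

/-- `f` satisfies the mean value property at every site of `S`. -/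
def HarmonicOnSites (S : Finset ℤ) (f : ℤ → ℝ) : Prop :=
  ∀ a ∈ S, f a = (f (a - 1) + f (a + 1)) / 2

/-- Maximum principle: a positive maximum would be attained in the finite set `S` and would
propagate to the right for ever without leaving `S`. -/
theorem HarmonicOnSites.nonpos {S : Finset ℤ} {f : ℤ → ℝ} (hf : HarmonicOnSites S f)
    (h0 : ∀ a ∉ S, f a ≤ 0) (a : ℤ) : f a ≤ 0 := by
  by_contra! ha
  have haS : a ∈ S := by
    by_contra h
    exact absurd (h0 a h) (not_le.mpr ha)
  obtain ⟨b, hb, hmax⟩ := S.exists_max_image f ⟨a, haS⟩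
  have hpos : 0 < f b := ha.trans_le (hmax a haS)
  have hle : ∀ c, f c ≤ f b := fun c => by
    by_cases hc : c ∈ S
    · exact hmax c hc
    · exact (h0 c hc).trans hpos.le
  have hstep : ∀ k : ℕ, f (b + k) = f b := by
    intro k
    induction k with
    | zero => simp
    | succ k ih =>
      have hk : b + k ∈ S := by
        by_contra h
        exact absurd (h0 _ h) (by rw [ih]; exact not_le.mpr hpos)
      have h1 := hf _ hk
      have h2 := hle (b + k - 1)
      have h3 := hle (b + k + 1)
      push_cast
      rw [← add_assoc]
      linarith
  have hmem : ∀ k : ℕ, b + k ∈ S := fun k => by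
    by_contra h
    exact absurd (h0 _ h) (by rw [hstep]; exact not_le.mpr hpos)
  exact Set.infinite_of_injective_forall_mem (f := fun k : ℕ => b + (k : ℤ))
    (fun i j hij => by simpa using hij) hmem S.finite_toSet

theorem HarmonicOnSites.sub {S : Finset ℤ} {f g : ℤ → ℝ} (hf : HarmonicOnSites S f)
    (hg : HarmonicOnSites S g) : HarmonicOnSites S fun a => f a - g a := fun a ha => by
  have h1 := hf a ha
  have h2 := hg a ha
  linarith

/-- Uniqueness for the Dirichlet problem. It reduces identities between probabilities to starting
sites outside `S`, where the ball stops at once. -/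
theorem HarmonicOnSites.eq {S : Finset ℤ} {f g : ℤ → ℝ} (hf : HarmonicOnSites S f)
    (hg : HarmonicOnSites S g) (h : ∀ a ∉ S, f a = g a) (a : ℤ) : f a = g a := by
  have h1 := (hf.sub hg).nonpos (fun a ha => by simp [h a ha]) a
  have h2 := (hg.sub hf).nonpos (fun a ha => by simp [h a ha]) a
  linarith

theorem harmonicOnSites_supportProb (T S : Finset ℤ) (us : List ℤ) :
    HarmonicOnSites S fun a => supportProb T S (a :: us) :=
  fun _ ha => supportProb_cons_of_mem T us ha

/-- The probability is harmonic in the starting site of the second ball as well. -/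
theorem harmonicOnSites_supportProb_second (T S : Finset ℤ) (us : List ℤ) (a : ℤ) :
    HarmonicOnSites S fun b => supportProb T S (a :: b :: us) := by
  intro b hb
  refine HarmonicOnSites.eq (S := S) (f := fun a => supportProb T S (a :: b :: us))
    (g := fun a => (supportProb T S (a :: (b - 1) :: us) +
      supportProb T S (a :: (b + 1) :: us)) / 2)
    (harmonicOnSites_supportProb T S _) (fun a ha => ?_) (fun a ha => ?_) a
  · have h1 := harmonicOnSites_supportProb T S ((b - 1) :: us) a ha
    have h2 := harmonicOnSites_supportProb T S ((b + 1) :: us) a ha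
    simp only at h1 h2 ⊢
    linarith
  -- The first ball stops at `a`, and `b` remains occupied in the enlarged set, so the mean value
  -- property at `b` is that of the next ball.
  · simp only [supportProb_cons_of_notMem T _ ha]
    exact supportProb_cons_of_mem T us (Finset.mem_insert_of_mem hb)

/-- Both sides are harmonic in each of the two starting sites, so both sites may be taken outside
`S`. There each ball stops where it starts if the sites differ, and the two orders coincide if they
agree. -/
theorem supportProb_swap (T S : Finset ℤ) (us : List ℤ) (a b : ℤ) :
    supportProb T S (a :: b :: us) = supportProb T S (b :: a :: us) := by
  have hout : ∀ a ∉ S, ∀ b, supportProb T S (a :: b :: us) = supportProb T S (b :: a :: us) := by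
    intro a ha b
    refine HarmonicOnSites.eq (harmonicOnSites_supportProb_second T S us a)
      (harmonicOnSites_supportProb T S (a :: us)) (fun b hb => ?_) b
    by_cases hab : a = b
    · simp [hab]
    · rw [supportProb_cons_of_notMem T _ ha, supportProb_cons_of_notMem T _ hb,
        supportProb_cons_of_notMem T _ (by simp [hb, Ne.symm hab]),
        supportProb_cons_of_notMem T _ (by simp [ha, hab]), Finset.insert_comm]
  exact HarmonicOnSites.eq (harmonicOnSites_supportProb_second T S us a)
    (harmonicOnSites_supportProb T S (a :: us)) (fun b hb => (hout b hb a).symm) b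

/-- The law of the final support does not depend on the order in which the balls are dropped. -/
theorem supportProb_perm (T S : Finset ℤ) {u v : List ℤ} (h : u.Perm v) :
    supportProb T S u = supportProb T S v := by
  induction h generalizing S with
  | nil => rfl
  | @cons a l₁ l₂ _ ih =>
    refine HarmonicOnSites.eq (harmonicOnSites_supportProb T S l₁)
      (harmonicOnSites_supportProb T S l₂) (fun b hb => ?_) a
    rw [supportProb_cons_of_notMem T _ hb, supportProb_cons_of_notMem T _ hb, ih]
  | swap a b l => exact supportProb_swap T S l b a
  | trans _ _ ih₁ ih₂ => exact (ih₁ S).trans (ih₂ S)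

/-- An occupied site is never freed. -/
theorem supportProb_eq_zero (T : Finset ℤ) {S : Finset ℤ} (us : List ℤ) (h : ¬ S ⊆ T) :
    supportProb T S us = 0 := by
  induction us generalizing S with
  | nil =>
    rw [supportProb_nil, if_neg]
    rintro rfl
    exact h subset_rfl
  | cons a us ih =>
    refine HarmonicOnSites.eq (g := fun _ => 0) (harmonicOnSites_supportProb T S us)
      (fun _ _ => by simp) (fun b hb => ?_) a
    rw [supportProb_cons_of_notMem T _ hb]
    exact ih fun hT => h ((Finset.subset_insert _ _).trans hT)

theorem supportProb_append (T S : Finset ℤ) (l us : List ℤ) (hl : l.Nodup)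
    (hd : ∀ a ∈ l, a ∉ S) : supportProb T S (l ++ us) = supportProb T (S ∪ l.toFinset) us := by
  induction l generalizing S with
  | nil => simp
  | cons a l ih =>
    rw [List.nodup_cons] at hl
    rw [List.cons_append, supportProb_cons_of_notMem T _ (hd a (by simp)), ih _ hl.2]
    · congr 1
      ext z
      simp
    · intro b hb
      rw [Finset.mem_insert, not_or]
      exact ⟨fun h => hl.1 (h ▸ hb), hd b (List.mem_cons_of_mem _ hb)⟩

/-- A ball dropped inside an occupied interval exits according to the gambler's ruin rule. -/
theorem supportProb_Ioo_cons (T : Finset ℤ) (us : List ℤ) (l : ℤ) (x y : ℕ) (hx : 0 < x)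
    (hy : 0 < y) :
    ((x : ℝ) + y) * supportProb T (Finset.Ioo l (l + y + x)) ((l + y) :: us) =
      x * supportProb T (Finset.Ioo (l - 1) (l + y + x)) us +
        y * supportProb T (Finset.Ioo l (l + y + x + 1)) us := by
  set S := Finset.Ioo l (l + y + x) with hS
  set f : ℤ → ℝ := fun a => supportProb T S (a :: us) with hf
  -- Harmonic on an integer interval means affine up to and including the two empty sites at its
  -- ends.
  have hlin : ∀ k : ℕ, k ≤ y + x → f (l + k) = f l + k * (f (l + 1) - f l) := by
    intro k
    induction k using Nat.strong_induction_on with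
    | _ k ih =>
      intro hk
      match k with
      | 0 => simp
      | 1 => simp
      | k + 2 =>
        have h0 := ih k (by omega) (by omega)
        have h1 := ih (k + 1) (by omega) (by omega)
        have hm : l + ((k + 1 : ℕ) : ℤ) ∈ S := by
          simp only [hS, Finset.mem_Ioo]; omega
        have h2 := harmonicOnSites_supportProb T S us _ hm
        change f _ = (f _ + f _) / 2 at h2
        rw [show l + ((k + 1 : ℕ) : ℤ) - 1 = l + k by push_cast; ring,
          show l + ((k + 1 : ℕ) : ℤ) + 1 = l + ((k + 2 : ℕ) : ℤ) by push_cast; ring] at h2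
        push_cast at h0 h1 h2 ⊢
        linarith
  have hl : f l = supportProb T (Finset.Ioo (l - 1) (l + y + x)) us := by
    rw [hf]
    simp only
    rw [supportProb_cons_of_notMem T _ (by simp [hS])]
    congr 1
    ext z
    simp only [hS, Finset.mem_insert, Finset.mem_Ioo]
    omega
  have hm : f (l + (y + x : ℕ)) = supportProb T (Finset.Ioo l (l + y + x + 1)) us := by
    rw [hf]
    simp only
    rw [supportProb_cons_of_notMem T _ (by simp [hS]; omega)]
    congr 1
    ext z
    simp only [hS, Finset.mem_insert, Finset.mem_Ioo]
    omega
  have h1 := hlin y (by omega)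
  have h2 := hlin (y + x) le_rfl
  rw [← hl, ← hm]
  change _ * f (l + y) = _
  rw [h1, h2]
  push_cast
  ring

/-! ## A recurrence for the Carlitz–Scoville numbers -/

open MvPowerSeries in
/-- The Euler operator `X₀ ∂₀ + X₁ ∂₁`. -/
def eulerOp : Derivation ℝ (MvPowerSeries (Fin 2) ℝ) (MvPowerSeries (Fin 2) ℝ) :=
  (X 0 : MvPowerSeries (Fin 2) ℝ) • pderiv ℝ 0 + (X 1 : MvPowerSeries (Fin 2) ℝ) • pderiv ℝ 1

theorem coeff_X_mul (i : Fin 2) (f : MvPowerSeries (Fin 2) ℝ) (m : Fin 2 →₀ ℕ) :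
    MvPowerSeries.coeff m (MvPowerSeries.X i * f) =
      if m i = 0 then 0 else MvPowerSeries.coeff (m - Finsupp.single i 1) f :=
  coeff_X_mul_csAux i f m

theorem coeff_X_mul_pderiv (i : Fin 2) (f : MvPowerSeries (Fin 2) ℝ) (m : Fin 2 →₀ ℕ) :
    MvPowerSeries.coeff m (MvPowerSeries.X i * MvPowerSeries.pderiv ℝ i f) =
      m i * MvPowerSeries.coeff m f := by
  rw [coeff_X_mul]
  split_ifs with h
  · simp [h]
  · have hle : Finsupp.single i 1 ≤ m := by
      rw [Finsupp.single_le_iff]; omega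
    rw [MvPowerSeries.coeff_pderiv, tsub_add_cancel_of_le hle, mul_comm]
    congr 1
    rw [Finsupp.tsub_apply, Finsupp.single_eq_same, Nat.cast_sub (by omega)]
    simp

theorem coeff_eulerOp (f : MvPowerSeries (Fin 2) ℝ) (m : Fin 2 →₀ ℕ) :
    MvPowerSeries.coeff m (eulerOp f) = ((m 0 : ℝ) + m 1) * MvPowerSeries.coeff m f := by
  have h : eulerOp f = MvPowerSeries.X 0 * MvPowerSeries.pderiv ℝ 0 f +
      MvPowerSeries.X 1 * MvPowerSeries.pderiv ℝ 1 f := rfl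
  rw [h, map_add, coeff_X_mul_pderiv, coeff_X_mul_pderiv, add_mul]

theorem eulerOp_X (i : Fin 2) :
    eulerOp (MvPowerSeries.X i) = MvPowerSeries.X i := by
  ext m
  rw [coeff_eulerOp, MvPowerSeries.coeff_X]
  split_ifs with h
  · subst h; fin_cases i <;> simp
  · simp

theorem eulerOp_expX (i : Fin 2) : eulerOp (expX i) = MvPowerSeries.X i * expX i := by
  ext m
  rw [coeff_eulerOp, coeff_X_mul_csAux]
  change _ * expX i m = _
  fin_cases i
  · simp only [expX, Fin.zero_eta, eq_single_zero_iff_csAux]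
    rcases h0 : m 0 with _ | a <;> by_cases h1 : m 1 = 0 <;>
      simp [h0, h1, Nat.factorial_succ]
    field_simp
  · simp only [expX, Fin.mk_one, eq_single_one_iff_csAux]
    rcases h0 : m 1 with _ | a <;> by_cases h1 : m 0 = 0 <;>
      simp [h0, h1, Nat.factorial_succ]
    field_simp

/-- Numerator and denominator of F are known in closed form only after multiplication by X₀ - X₁;
this factor is cancelled below. -/
theorem X_zero_sub_X_one_ne_zero :
    (MvPowerSeries.X 0 - MvPowerSeries.X 1 : MvPowerSeries (Fin 2) ℝ) ≠ 0 := by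
  rw [sub_ne_zero]
  exact fun h => zero_ne_one (MvPowerSeries.X_inj.mp h)

theorem sub_mul_csDen : (MvPowerSeries.X 0 - MvPowerSeries.X 1) * csDen =
    MvPowerSeries.X 0 * expX 1 - MvPowerSeries.X 1 * expX 0 := by
  rw [csDen, expX_eq_csAux 0, expX_eq_csAux 1]
  linear_combination -(MvPowerSeries.X 0 * MvPowerSeries.X 1) * sub_mul_csAux 1

theorem sub_mul_csNum :
    (MvPowerSeries.X 0 - MvPowerSeries.X 1) * csNum = expX 0 - expX 1 := by
  rw [csNum, sub_mul_csAux 0]; rfl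

theorem constantCoeff_csDen : MvPowerSeries.constantCoeff csDen = 1 := by simp [csDen]

theorem csDen_ne_zero : csDen ≠ 0 := fun h => by
  have := constantCoeff_csDen
  simp [h] at this

theorem csDen_mul_csF : csDen * csF = csNum := by
  rw [csF, mul_left_comm, MvPowerSeries.mul_inv_cancel _ (by simp [constantCoeff_csDen]), mul_one]

theorem csDen_mul_one_add_X_mul_csF (i : Fin 2) :
    csDen * (1 + MvPowerSeries.X i * csF) = expX i := by
  apply mul_left_cancel₀ X_zero_sub_X_one_ne_zero
  obtain rfl | rfl : i = 0 ∨ i = 1 := by omega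
  · linear_combination (MvPowerSeries.X 0 - MvPowerSeries.X 1) * MvPowerSeries.X 0 * csDen_mul_csF
      + sub_mul_csDen + MvPowerSeries.X 0 * sub_mul_csNum
  · linear_combination (MvPowerSeries.X 0 - MvPowerSeries.X 1) * MvPowerSeries.X 1 * csDen_mul_csF
      + sub_mul_csDen + MvPowerSeries.X 1 * sub_mul_csNum

theorem eulerOp_csDen :
    eulerOp csDen = - (MvPowerSeries.X 0 * MvPowerSeries.X 1 * csNum) := by
  apply mul_left_cancel₀ X_zero_sub_X_one_ne_zero
  have h := congrArg eulerOp sub_mul_csDen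
  simp only [Derivation.leibniz, map_sub, eulerOp_X, eulerOp_expX, smul_eq_mul] at h
  linear_combination h - sub_mul_csDen +
    MvPowerSeries.X 0 * MvPowerSeries.X 1 * sub_mul_csNum

/-- Write D for `csDen` and ϑ for `eulerOp`. Apply ϑ to D(1 + XᵢF) = exp Xᵢ, use ϑD = -X₀X₁DF and
cancel D: this leaves ϑ(1 + XᵢF) = (Xᵢ + X₀X₁F)(1 + XᵢF). -/
theorem eulerOp_one_add_X_mul_csF (i : Fin 2) :
    eulerOp (1 + MvPowerSeries.X i * csF) = MvPowerSeries.X i *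
      ((1 + MvPowerSeries.X 0 * csF) * (1 + MvPowerSeries.X 1 * csF)) := by
  apply mul_left_cancel₀ csDen_ne_zero
  have h := congrArg eulerOp (csDen_mul_one_add_X_mul_csF i)
  rw [Derivation.leibniz, eulerOp_csDen, eulerOp_expX, smul_eq_mul, smul_eq_mul,
    ← csDen_mul_csF, ← csDen_mul_one_add_X_mul_csF i] at h
  obtain rfl | rfl : i = 0 ∨ i = 1 := by omega
  · linear_combination h
  · linear_combination h

theorem eulerOp_csGenerating (x y : ℕ) :
    eulerOp ((1 + MvPowerSeries.X 0 * csF) ^ x * (1 + MvPowerSeries.X 1 * csF) ^ y) =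
      (x : MvPowerSeries (Fin 2) ℝ) * (MvPowerSeries.X 0 *
        ((1 + MvPowerSeries.X 0 * csF) ^ x * (1 + MvPowerSeries.X 1 * csF) ^ (y + 1))) +
      (y : MvPowerSeries (Fin 2) ℝ) * (MvPowerSeries.X 1 *
        ((1 + MvPowerSeries.X 0 * csF) ^ (x + 1) * (1 + MvPowerSeries.X 1 * csF) ^ y)) := by
  rw [Derivation.leibniz, Derivation.leibniz_pow, Derivation.leibniz_pow,
    eulerOp_one_add_X_mul_csF, eulerOp_one_add_X_mul_csF]
  simp only [smul_eq_mul, nsmul_eq_mul]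
  -- The truncated exponent `k - 1` is harmless at `k = 0` because of the factor `k`.
  have hpow : ∀ (k : ℕ) (a : MvPowerSeries (Fin 2) ℝ), k * (a ^ (k - 1) * a) = k * a ^ k := by
    rintro (_ | k) a
    · simp
    · rw [Nat.add_sub_cancel, pow_succ]
  linear_combination
    ((1 + MvPowerSeries.X 0 * csF) ^ (x + 1) * MvPowerSeries.X 1) *
        hpow y (1 + MvPowerSeries.X 1 * csF) +
      ((1 + MvPowerSeries.X 1 * csF) ^ (y + 1) * MvPowerSeries.X 0) *
        hpow x (1 + MvPowerSeries.X 0 * csF)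

theorem carlitzScoville_zero_zero (x y : ℕ) : carlitzScoville 0 0 x y = 1 := by
  simp [carlitzScoville]

theorem carlitzScoville_rec (r s x y : ℕ) (h : 0 < r + s) :
    carlitzScoville r s x y =
      (if r = 0 then 0 else x * carlitzScoville (r - 1) s x (y + 1)) +
      (if s = 0 then 0 else y * carlitzScoville r (s - 1) (x + 1) y) := by
  have key := congrArg (MvPowerSeries.coeff (Finsupp.single 0 r + Finsupp.single 1 s))
    (eulerOp_csGenerating x y)
  rw [coeff_eulerOp, map_add, ← nsmul_eq_mul, ← nsmul_eq_mul, map_nsmul, map_nsmul,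
    coeff_X_mul, coeff_X_mul, nsmul_eq_mul, nsmul_eq_mul] at key
  have h0 : (Finsupp.single 0 r + Finsupp.single 1 s : Fin 2 →₀ ℕ) 0 = r := by simp
  have h1 : (Finsupp.single 0 r + Finsupp.single 1 s : Fin 2 →₀ ℕ) 1 = s := by simp
  have e0 : (Finsupp.single 0 r + Finsupp.single 1 s : Fin 2 →₀ ℕ) - Finsupp.single 0 1 =
      Finsupp.single 0 (r - 1) + Finsupp.single 1 s := by
    ext i; fin_cases i <;> simp
  have e1 : (Finsupp.single 0 r + Finsupp.single 1 s : Fin 2 →₀ ℕ) - Finsupp.single 1 1 =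
      Finsupp.single 0 r + Finsupp.single 1 (s - 1) := by
    ext i; fin_cases i <;> simp
  rw [h0, h1, e0, e1] at key
  obtain ⟨d, hd⟩ : ∃ d, r + s = d + 1 := ⟨r + s - 1, by omega⟩
  have hcast : (r : ℝ) + s = d + 1 := by exact_mod_cast hd
  have hr : r ≠ 0 → r - 1 + s = d := by omega
  have hs : s ≠ 0 → r + (s - 1) = d := by omega
  -- The degree r + s produced by the Euler operator is the factor that lowers (r + s)! to (r + s -
  -- 1)!, the normalisation of both terms on the right.
  have hlhs : carlitzScoville r s x y = (d ! : ℝ) * (((r : ℝ) + s) *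
      MvPowerSeries.coeff (Finsupp.single 0 r + Finsupp.single 1 s)
      ((1 + MvPowerSeries.X 0 * csF) ^ x * (1 + MvPowerSeries.X 1 * csF) ^ y)) := by
    rw [carlitzScoville, hd, Nat.factorial_succ, hcast]
    push_cast
    ring
  rw [hlhs, key, mul_add]
  congr 1
  · split_ifs with hr0
    · simp
    · rw [carlitzScoville, hr hr0]
      ring
  · split_ifs with hs0
    · simp
    · rw [carlitzScoville, hs hs0]
      ring

/-! ## Rook numbers of Ferrers boards -/

theorem mem_rookPlacements {n : ℕ} {B : Finset (Fin n × Fin n)} {k : ℕ}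
    {P : Finset (Fin n × Fin n)} : P ∈ rookPlacements B k ↔ (P ⊆ B ∧ P.card = k) ∧
      ∀ a ∈ P, ∀ b ∈ P, a ≠ b → a.1 ≠ b.1 ∧ a.2 ≠ b.2 := by
  rw [rookPlacements, Finset.mem_filter, Finset.mem_powersetCard]

theorem rookPlacements_zero {n : ℕ} (B : Finset (Fin n × Fin n)) :
    rookPlacements B 0 = {∅} := by
  ext P
  rw [mem_rookPlacements, Finset.card_eq_zero, Finset.mem_singleton]
  constructor
  · exact fun h => h.1.2
  · rintro rfl
    simp

theorem qRook_one {n : ℕ} (B : Finset (Fin n × Fin n)) (k : ℕ) :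
    qRook 1 B k = (rookPlacements B k).card := by
  simp [qRook]

/-- The first `j` columns of the board with column heights `b`. -/
def columnBoard {n : ℕ} (b : Fin n → ℕ) (j : ℕ) : Finset (Fin n × Fin n) :=
  Finset.univ.filter fun c => (c.1 : ℕ) < j ∧ (c.2 : ℕ) < b c.1

theorem mem_columnBoard {n : ℕ} {b : Fin n → ℕ} {j : ℕ} {c : Fin n × Fin n} :
    c ∈ columnBoard b j ↔ (c.1 : ℕ) < j ∧ (c.2 : ℕ) < b c.1 := by
  simp [columnBoard]

theorem rookPlacements_columnBoard_eq_empty {n : ℕ} (b : Fin n → ℕ) {j k : ℕ} (h : j < k) :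
    rookPlacements (columnBoard b j) k = ∅ := by
  rw [Finset.eq_empty_iff_forall_notMem]
  intro P hP
  rw [mem_rookPlacements] at hP
  obtain ⟨⟨hsub, hcard⟩, hna⟩ := hP
  have h1 : P.card ≤ (Finset.range j).card := by
    refine Finset.card_le_card_of_injOn (fun c => (c.1 : ℕ)) (fun c hc => ?_) ?_
    · simpa using (mem_columnBoard.mp (hsub hc)).1
    · intro a ha c hc hac
      by_contra hne
      exact (hna a ha c hc hne).1 (Fin.ext hac)
  rw [Finset.card_range] at h1
  omega

/-- The rows below height `h` that contain no rook of `P`. -/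
def freeRows {n : ℕ} (P : Finset (Fin n × Fin n)) (h : ℕ) : Finset (Fin n) :=
  (Finset.univ.filter fun i : Fin n => (i : ℕ) < h) \ P.image Prod.snd

/-- The `k` rooks occupy `k` distinct rows, all below height `h` as no column in play is taller. The
existence of `P` forces `k ≤ h`, so the real subtraction is a true count. -/
theorem card_freeRows {n : ℕ} {b : Fin n → ℕ} {j k h : ℕ} {P : Finset (Fin n × Fin n)}
    (hP : P ∈ rookPlacements (columnBoard b j) k) (hh : h ≤ n)
    (hb : ∀ i : Fin n, (i : ℕ) < j → b i ≤ h) : ((freeRows P h).card : ℝ) = h - k := by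
  rw [mem_rookPlacements] at hP
  obtain ⟨⟨hsub, hcard⟩, hna⟩ := hP
  have h1 : (Finset.univ.filter fun i : Fin n => (i : ℕ) < h).card = h := by
    rw [Fin.card_filter_val_lt, min_eq_right hh]
  have h2 : (P.image Prod.snd).card = k := by
    rw [Finset.card_image_of_injOn, hcard]
    intro a ha c hc hac
    by_contra hne
    exact (hna a ha c hc hne).2 hac
  have h3 : P.image Prod.snd ⊆ Finset.univ.filter fun i : Fin n => (i : ℕ) < h := by
    intro i hi
    obtain ⟨c, hc, rfl⟩ := Finset.mem_image.mp hi
    have := mem_columnBoard.mp (hsub hc)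
    simpa using this.2.trans_le (hb _ this.1)
  have h4 : k ≤ h := h2 ▸ h1 ▸ Finset.card_le_card h3
  rw [freeRows, Finset.card_sdiff_of_subset h3, h1, h2, Nat.cast_sub h4]

/-- Either column `j` is empty, or its rook stands in one of the rows left free by the `k` rooks in
the shorter columns to its left. -/
theorem card_rookPlacements_columnBoard_succ {n : ℕ} {b : Fin n → ℕ} (j : Fin n) (k : ℕ)
    (hbn : b j ≤ n) (hb : ∀ i < j, b i ≤ b j) :
    ((rookPlacements (columnBoard b (j + 1)) (k + 1)).card : ℝ) =
      (rookPlacements (columnBoard b j) (k + 1)).card +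
        ((b j : ℝ) - k) * (rookPlacements (columnBoard b j) k).card := by
  classical
  set A := rookPlacements (columnBoard b (j + 1)) (k + 1) with hA
  have hsplit := Finset.card_filter_add_card_filter_not (s := A) fun P => ∀ c ∈ P, c.1 ≠ j
  have h1 : A.filter (fun P => ∀ c ∈ P, c.1 ≠ j) = rookPlacements (columnBoard b j) (k + 1) := by
    ext P
    rw [Finset.mem_filter, hA, mem_rookPlacements, mem_rookPlacements]
    constructor
    · rintro ⟨⟨⟨hs, hc⟩, hna⟩, hj⟩
      refine ⟨⟨fun c hcP => ?_, hc⟩, hna⟩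
      have h := mem_columnBoard.mp (hs hcP)
      have hne : (c.1 : ℕ) ≠ j := fun h => hj c hcP (Fin.ext h)
      exact mem_columnBoard.mpr ⟨by omega, h.2⟩
    · rintro ⟨⟨hs, hc⟩, hna⟩
      refine ⟨⟨⟨fun c hcP => ?_, hc⟩, hna⟩, fun c hcP hcj => ?_⟩
      · have h := mem_columnBoard.mp (hs hcP)
        exact mem_columnBoard.mpr ⟨by omega, h.2⟩
      · have h := mem_columnBoard.mp (hs hcP)
        rw [hcj] at h
        omega
  have h2 : (A.filter fun P => ¬ ∀ c ∈ P, c.1 ≠ j).card =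
      ((rookPlacements (columnBoard b j) k).sigma fun P => freeRows P (b j)).card := by
    symm
    have hnot : ∀ P ∈ rookPlacements (columnBoard b j) k, ∀ y, (j, y) ∉ P := by
      intro P hP y hy
      have := mem_columnBoard.mp ((mem_rookPlacements.mp hP).1.1 hy)
      simp at this
    refine Finset.card_bij (fun p _ => insert (j, p.2) p.1) ?_ ?_ ?_
    · rintro ⟨P, y⟩ hp
      rw [Finset.mem_sigma] at hp
      obtain ⟨hP, hy⟩ := hp
      have hnP := hnot P hP y
      obtain ⟨⟨hs, hc⟩, hna⟩ := mem_rookPlacements.mp hP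
      simp only [freeRows, Finset.mem_sdiff, Finset.mem_filter, Finset.mem_univ, true_and,
        Finset.mem_image, not_exists, not_and] at hy
      have hcol : ∀ c ∈ P, c.1 ≠ j := fun c hcP h => by
        have := (mem_columnBoard.mp (hs hcP)).1
        rw [h] at this
        omega
      rw [Finset.mem_filter, hA, mem_rookPlacements]
      refine ⟨⟨⟨?_, by rw [Finset.card_insert_of_notMem hnP, hc]⟩, ?_⟩, ?_⟩
      · intro c hcP
        rw [Finset.mem_insert] at hcP
        rcases hcP with rfl | hcP
        · exact mem_columnBoard.mpr ⟨by simp, hy.1⟩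
        · have := mem_columnBoard.mp (hs hcP)
          exact mem_columnBoard.mpr ⟨by omega, this.2⟩
      · intro a ha c hcP hne
        rw [Finset.mem_insert] at ha hcP
        rcases ha with rfl | ha <;> rcases hcP with rfl | hcP
        · exact absurd rfl hne
        · exact ⟨(hcol c hcP).symm, fun h => hy.2 c hcP h.symm⟩
        · exact ⟨hcol a ha, hy.2 a ha⟩
        · exact hna a ha c hcP hne
      · push Not
        exact ⟨(j, y), Finset.mem_insert_self _ _, rfl⟩
    · rintro ⟨P, y⟩ hp ⟨Q, z⟩ hq h
      rw [Finset.mem_sigma] at hp hq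
      simp only at h hp hq
      have hyz : y = z := by
        have : (j, y) ∈ insert (j, z) Q := h ▸ Finset.mem_insert_self _ _
        rw [Finset.mem_insert] at this
        rcases this with h' | h'
        · exact (Prod.ext_iff.mp h').2
        · exact absurd h' (hnot Q hq.1 y)
      subst hyz
      have hPQ : P = Q := by
        rw [← Finset.erase_insert (hnot P hp.1 y), h, Finset.erase_insert (hnot Q hq.1 y)]
      subst hPQ
      rfl
    · intro P hP
      rw [Finset.mem_filter, hA, mem_rookPlacements] at hP
      obtain ⟨⟨⟨hs, hc⟩, hna⟩, hex⟩ := hP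
      push Not at hex
      obtain ⟨⟨i, y⟩, hcP, hij⟩ := hex
      simp only at hij
      subst hij
      refine ⟨⟨P.erase (i, y), y⟩, ?_, Finset.insert_erase hcP⟩
      rw [Finset.mem_sigma, mem_rookPlacements]
      refine ⟨⟨⟨fun c hc' => ?_, ?_⟩, fun a ha c hc' => ?_⟩, ?_⟩
      · have hcP' := Finset.mem_of_mem_erase hc'
        have h := mem_columnBoard.mp (hs hcP')
        have hne : (c.1 : ℕ) ≠ i := fun h' =>
          (hna c hcP' _ hcP (Finset.ne_of_mem_erase hc')).1 (Fin.ext h')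
        exact mem_columnBoard.mpr ⟨by omega, h.2⟩
      · rw [Finset.card_erase_of_mem hcP, hc, Nat.add_sub_cancel]
      · exact hna a (Finset.mem_of_mem_erase ha) c (Finset.mem_of_mem_erase hc')
      · simp only [freeRows, Finset.mem_sdiff, Finset.mem_filter, Finset.mem_univ, true_and,
          Finset.mem_image, not_exists, not_and]
        refine ⟨(mem_columnBoard.mp (hs hcP)).2, fun c hc' h => ?_⟩
        exact (hna c (Finset.mem_of_mem_erase hc') _ hcP (Finset.ne_of_mem_erase hc')).2 h
  rw [← hsplit, h1, h2, Finset.card_sigma]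
  push_cast
  rw [Finset.sum_congr rfl fun P hP => card_freeRows hP hbn fun i hi => hb i hi,
    Finset.sum_const, nsmul_eq_mul]
  ring

theorem cast_descFactorial_succ (z m : ℕ) :
    ((z.descFactorial (m + 1) : ℕ) : ℝ) = ((z : ℝ) - m) * (z.descFactorial m : ℕ) := by
  rw [Nat.descFactorial_succ]
  rcases le_or_gt m z with h | h
  · rw [Nat.cast_mul, Nat.cast_sub h]
  · rw [Nat.descFactorial_of_lt h]
    simp

/-- The Goldman–Joichi–White factorisation of the factorial rook polynomial. -/
theorem sum_card_rookPlacements_mul_descFactorial {n : ℕ} {b : Fin n → ℕ} (hb : Monotone b)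
    (hbn : ∀ i, b i ≤ n) (z : ℕ) {j : ℕ} (hj : j ≤ n) :
    ∑ k ∈ Finset.range (j + 1), ((rookPlacements (columnBoard b j) k).card : ℝ) *
      (z.descFactorial (j - k) : ℕ) =
    ∏ i : Fin j, ((z : ℝ) + b (Fin.castLE hj i) - i) := by
  induction j with
  | zero => simp [rookPlacements_zero]
  | succ j ih =>
    have ih := ih (by omega)
    rw [Fin.prod_univ_castSucc]
    have hcast : ∀ i : Fin j, Fin.castLE hj i.castSucc = Fin.castLE (by omega : j ≤ n) i :=
      fun i => rfl
    simp only [hcast, Fin.val_castSucc]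
    rw [← ih]
    set c : Fin n := ⟨j, hj⟩ with hc
    have hlast : Fin.castLE hj (Fin.last j) = c := rfl
    rw [hlast, Fin.val_last]
    have hrec := fun k => card_rookPlacements_columnBoard_succ (b := b) c k (hbn c)
      fun i hi => hb hi.le
    have hcj : (c : ℕ) = j := rfl
    rw [hcj] at hrec
    rw [Finset.sum_range_succ']
    simp only [hrec, rookPlacements_zero, Nat.add_sub_add_right, add_mul, Finset.sum_add_distrib]
    -- Reindexing the placements with empty last column; the top term vanishes, since `j` columns
    -- cannot hold `j + 1` rooks.
    have h2 : ∑ k ∈ Finset.range (j + 1),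
        ((rookPlacements (columnBoard b j) (k + 1)).card : ℝ) * (z.descFactorial (j - k) : ℕ) +
        (({∅} : Finset (Finset (Fin n × Fin n))).card : ℝ) * (z.descFactorial (j + 1 - 0) : ℕ) =
        ∑ k ∈ Finset.range (j + 1), ((rookPlacements (columnBoard b j) k).card : ℝ) *
          (z.descFactorial (j + 1 - k) : ℕ) := by
      have h3 := Finset.sum_range_succ' (fun k =>
        ((rookPlacements (columnBoard b j) k).card : ℝ) * (z.descFactorial (j + 1 - k) : ℕ)) (j + 1)
      rw [Finset.sum_range_succ, rookPlacements_columnBoard_eq_empty b (Nat.lt_succ_self j),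
        rookPlacements_zero] at h3
      simpa using h3.symm
    rw [add_right_comm, h2, ← Finset.sum_add_distrib, Finset.sum_mul]
    refine Finset.sum_congr rfl fun k hk => ?_
    have hkj : k ≤ j := Nat.lt_succ_iff.mp (Finset.mem_range.mp hk)
    -- The weights z - (j - k), for an empty last column, and b_j - k, for a rook in it, add up to z
    -- + b_j - j, which does not depend on k.
    rw [Nat.succ_sub hkj, Nat.succ_eq_add_one, cast_descFactorial_succ, Nat.cast_sub hkj]
    ring

/-! ## Hit numbers as coefficients of power series -/

theorem one_sub_X_pow_mul_mk_choose (k : ℕ) :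
    (1 - PowerSeries.X : PowerSeries ℝ) ^ (k + 1) *
      PowerSeries.mk (fun z => ((z.choose k : ℕ) : ℝ)) = PowerSeries.X ^ k := by
  have h : PowerSeries.mk (fun z => ((z.choose k : ℕ) : ℝ)) =
      PowerSeries.X ^ k * PowerSeries.mk (fun z => (((k + z).choose k : ℕ) : ℝ)) := by
    ext z
    rw [PowerSeries.coeff_X_pow_mul', PowerSeries.coeff_mk]
    split_ifs with hk
    · rw [PowerSeries.coeff_mk, Nat.add_sub_cancel' hk]
    · rw [Nat.choose_eq_zero_of_lt (by omega), Nat.cast_zero]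
  rw [h]
  linear_combination (PowerSeries.X : PowerSeries ℝ) ^ k *
    PowerSeries.mk_add_choose_mul_one_sub_pow_eq_one ℝ k

theorem qFactorial_one (n : ℕ) : qFactorial 1 n = (n ! : ℝ) := by
  have h : ∀ i, qInt 1 i = i := fun i => by simp [qInt]
  induction n with
  | zero => simp [qFactorial]
  | succ n ih =>
    rw [qFactorial, Finset.prod_Icc_succ_top (by omega), h, Nat.factorial_succ]
    rw [qFactorial] at ih
    rw [ih]
    push_cast
    ring

/-- Since ∑ C(z,k) t^z = t^k / (1 - t)^(k+1), each t^k (1 - t)^(n-k) equals (1 - t)^(n+1) ∑ C(z,k)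
t^z, and k! C(z,k) is the falling factorial. The two sums are matched by k ↦ n - k. -/
theorem coe_qHitPolynomial_one {n : ℕ} (lam : Fin n → ℕ) :
    ((qHitPolynomial 1 lam : Polynomial ℝ) : PowerSeries ℝ) =
      (1 - PowerSeries.X) ^ (n + 1) * PowerSeries.mk (fun z =>
        ∑ k ∈ Finset.range (n + 1), ((rookPlacements (complementBoard lam) k).card : ℝ) *
          (z.descFactorial (n - k) : ℕ)) := by
  have hmk : PowerSeries.mk (fun z =>
        ∑ k ∈ Finset.range (n + 1), ((rookPlacements (complementBoard lam) k).card : ℝ) *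
          (z.descFactorial (n - k) : ℕ)) =
      ∑ k ∈ Finset.range (n + 1),
        PowerSeries.C (((rookPlacements (complementBoard lam) (n - k)).card : ℝ) * (k ! : ℝ)) *
          PowerSeries.mk (fun z => ((z.choose k : ℕ) : ℝ)) := by
    ext z
    rw [PowerSeries.coeff_mk, map_sum, ← Finset.sum_range_reflect]
    refine Finset.sum_congr rfl fun k hk => ?_
    have hk : k ≤ n := Nat.lt_succ_iff.mp (Finset.mem_range.mp hk)
    rw [PowerSeries.coeff_C_mul, PowerSeries.coeff_mk, Nat.add_sub_cancel,
      Nat.sub_sub_self hk, Nat.descFactorial_eq_factorial_mul_choose]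
    push_cast
    ring
  have hcoe : ((qHitPolynomial 1 lam : Polynomial ℝ) : PowerSeries ℝ) =
      ∑ k ∈ Finset.range (n + 1),
        PowerSeries.C (((rookPlacements (complementBoard lam) (n - k)).card : ℝ) * (k ! : ℝ)) *
          PowerSeries.X ^ k * (1 - PowerSeries.X) ^ (n - k) := by
    rw [qHitPolynomial, ← Polynomial.coeToPowerSeries.ringHom_apply, map_sum]
    refine Finset.sum_congr rfl fun k _ => ?_
    simp only [qRook_one, qFactorial_one, one_pow, map_one, one_mul, Finset.prod_const,
      Nat.card_Icc, Nat.add_sub_add_right, map_mul, map_pow, map_sub,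
      Polynomial.coeToPowerSeries.ringHom_apply, Polynomial.coe_C, Polynomial.coe_X]
  rw [hcoe, hmk, Finset.mul_sum]
  refine Finset.sum_congr rfl fun k hk => ?_
  have hk : k ≤ n := Nat.lt_succ_iff.mp (Finset.mem_range.mp hk)
  rw [← one_sub_X_pow_mul_mk_choose k, show n + 1 = (k + 1) + (n - k) by omega, pow_add]
  ring

theorem coe_qHitPolynomial_one_eq_prod {n : ℕ} {lam : Fin n → ℕ} (hlam : Antitone lam) :
    ((qHitPolynomial 1 lam : Polynomial ℝ) : PowerSeries ℝ) =
      (1 - PowerSeries.X) ^ (n + 1) * PowerSeries.mk (fun z =>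
        ∏ i : Fin n, ((z : ℝ) + ((n - lam i : ℕ) : ℝ) - (i : ℕ))) := by
  have hboard : complementBoard lam = columnBoard (fun i => n - lam i) n := by
    ext c
    simp [mem_columnBoard, complementBoard]
  rw [coe_qHitPolynomial_one, hboard]
  congr 2
  ext z
  exact sum_card_rookPlacements_mul_descFactorial (b := fun i => n - lam i)
    (fun i j hij => Nat.sub_le_sub_left (hlam hij) n) (fun i => Nat.sub_le _ _) z le_rfl

/-- The coefficients of `(1 - t) ^ (d + x + y) ∑ (z + y) ^ d C(z + x + y - 1, x + y - 1) t ^ z`. -/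
def eulerCoeff (d r x y : ℕ) : ℝ :=
  PowerSeries.coeff r ((1 - PowerSeries.X : PowerSeries ℝ) ^ (d + x + y) *
    PowerSeries.mk fun z => ((z : ℝ) + y) ^ d * (((z + (x + y - 1)).choose (x + y - 1) : ℕ) : ℝ))

theorem eulerCoeff_zero (r x y : ℕ) (h : 0 < x + y) :
    eulerCoeff 0 r x y = if r = 0 then 1 else 0 := by
  obtain ⟨m, hm⟩ : ∃ m, x + y = m + 1 := ⟨x + y - 1, by omega⟩
  have := PowerSeries.mk_add_choose_mul_one_sub_pow_eq_one ℝ m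
  rw [eulerCoeff, zero_add, hm, Nat.add_sub_cancel, ← PowerSeries.coeff_one, mul_comm]
  simp only [pow_zero, one_mul, add_comm _ m, this]

/-- With m = x + y - 1, one factor z + y is absorbed by (z + y) C(z+m, m) = x C(z+m, m+1) + y
C(z+m+1, m+1). The first part vanishes at z = 0 and, after the shift z ↦ z + 1, is t times the
series for (x, y + 1); the second is the series for (x + 1, y). -/
theorem eulerCoeff_succ (d r x y : ℕ) (h : 0 < x + y) :
    eulerCoeff (d + 1) r x y =
      (if r = 0 then 0 else x * eulerCoeff d (r - 1) x (y + 1)) + y * eulerCoeff d r (x + 1) y := by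
  obtain ⟨m, hm⟩ : ∃ m, x + y = m + 1 := ⟨x + y - 1, by omega⟩
  have hxy : (x : ℝ) + y = m + 1 := by exact_mod_cast hm
  have hch : ∀ z : ℕ, (x : ℝ) * ((z + m).choose (m + 1) : ℕ) +
      y * ((z + (m + 1)).choose (m + 1) : ℕ) = (z + y) * ((z + m).choose m : ℕ) := by
    intro z
    have h1 : (((z + m).choose (m + 1) : ℕ) : ℝ) * (m + 1) = ((z + m).choose m : ℕ) * z := by
      have := Nat.choose_succ_right_eq (z + m) m
      rw [Nat.add_sub_cancel] at this
      exact_mod_cast this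
    have h2 : ((z : ℝ) + m + 1) * ((z + m).choose m : ℕ) =
        ((z + (m + 1)).choose (m + 1) : ℕ) * (m + 1) := by
      have := Nat.add_one_mul_choose_eq (z + m) m
      exact_mod_cast this
    have hm0 : (m : ℝ) + 1 ≠ 0 := by positivity
    apply mul_right_cancel₀ hm0
    linear_combination (x : ℝ) * h1 - (y : ℝ) * h2 +
      (z : ℝ) * ((z + m).choose m : ℕ) * hxy
  have hmk : PowerSeries.mk (fun z : ℕ => ((z : ℝ) + y) ^ (d + 1) * ((z + m).choose m : ℕ)) =
      PowerSeries.C (x : ℝ) * (PowerSeries.X * PowerSeries.mk (fun z : ℕ =>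
        ((z : ℝ) + (y + 1 : ℕ)) ^ d * ((z + (m + 1)).choose (m + 1) : ℕ))) +
      PowerSeries.C (y : ℝ) * PowerSeries.mk (fun z : ℕ =>
        ((z : ℝ) + y) ^ d * ((z + (m + 1)).choose (m + 1) : ℕ)) := by
    ext z
    rw [map_add, PowerSeries.coeff_C_mul, PowerSeries.coeff_C_mul, PowerSeries.coeff_mk,
      PowerSeries.coeff_mk]
    rcases z with _ | z
    · simp [pow_succ, mul_comm]
    · rw [PowerSeries.coeff_succ_X_mul, PowerSeries.coeff_mk]
      have := hch (z + 1)
      rw [show z + 1 + m = z + (m + 1) by omega] at this ⊢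
      push_cast at this ⊢
      rw [pow_succ, mul_assoc, ← this]
      ring
  have e1 : x + (y + 1) - 1 = m + 1 := by omega
  have e2 : x + 1 + y - 1 = m + 1 := by omega
  have e3 : x + y - 1 = m := by omega
  rw [eulerCoeff, eulerCoeff, eulerCoeff, e1, e2, e3, hmk, mul_add, map_add]
  congr 1
  · rw [mul_left_comm, PowerSeries.coeff_C_mul, mul_left_comm]
    rcases r with _ | r
    · simp
    · rw [PowerSeries.coeff_succ_X_mul, if_neg (Nat.succ_ne_zero r), Nat.add_sub_cancel,
        show d + 1 + x + y = d + x + (y + 1) by ring]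
  · rw [mul_left_comm, PowerSeries.coeff_C_mul, show d + 1 + x + y = d + (x + 1) + y by ring]

/-- Unlike `carlitzScoville_rec`, the recurrence `eulerCoeff_succ` has no case distinction on s;
this vanishing replaces it. -/
theorem eulerCoeff_eq_zero (d r x y : ℕ) (h : 0 < x + y) (hr : d < r) :
    eulerCoeff d r x y = 0 := by
  induction d generalizing r x y with
  | zero => rw [eulerCoeff_zero r x y h, if_neg (by omega)]
  | succ d ih =>
    rw [eulerCoeff_succ d r x y h, ih _ _ _ (by omega) (by omega),
      ih _ _ _ (by omega) (by omega)]
    simp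

theorem carlitzScoville_eq_eulerCoeff (r s x y : ℕ) (h : 0 < x + y) :
    carlitzScoville r s x y = eulerCoeff (r + s) r x y := by
  obtain ⟨d, hd⟩ : ∃ d, r + s = d := ⟨_, rfl⟩
  rw [hd]
  induction d generalizing r s x y with
  | zero =>
    obtain rfl : r = 0 := by omega
    obtain rfl : s = 0 := by omega
    rw [carlitzScoville_zero_zero, eulerCoeff_zero _ _ _ h, if_pos rfl]
  | succ d ih =>
    rw [carlitzScoville_rec r s x y (by omega), eulerCoeff_succ d r x y h]
    congr 1
    · split_ifs with hr
      · rfl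
      · rw [ih _ _ _ _ (by omega) (by omega)]
    · split_ifs with hs
      -- Here s = 0, so r = d + 1 exceeds d.
      · rw [eulerCoeff_eq_zero _ _ _ _ (by omega) (by omega), mul_zero]
      · rw [ih _ _ _ _ (by omega) (by omega)]

/-- The partition `λᵢ = min (r + s) (max 0 (r + s + x - i))`. -/
def csPartition (r s x y : ℕ) (k : Fin (r + s + x + y - 1)) : ℕ :=
  min (r + s) (r + s + x - 1 - (k : ℕ))

theorem csPartition_antitone (r s x y : ℕ) : Antitone (csPartition r s x y) := by
  intro i j hij
  have : (i : ℕ) ≤ j := hij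
  simp only [csPartition]
  omega

/-- The first x columns have height x + y - 1 and give z + y, …, z + x + y - 1 in reverse. Along the
next r + s the height grows with the index, so each gives z + y. The last y - 1 are full and give z
+ 1, …, z + y - 1 in reverse. -/
theorem prod_csPartition (r s x y z : ℕ) (hx : 0 < x) (hy : 0 < y) :
    ∏ i : Fin (r + s + x + y - 1),
      ((z : ℝ) + ((r + s + x + y - 1 - csPartition r s x y i : ℕ) : ℝ) - (i : ℕ)) =
    ((x + y - 1)! : ℝ) * (((z : ℝ) + y) ^ (r + s) * ((z + (x + y - 1)).choose (x + y - 1) : ℕ)) := by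
  simp only [csPartition]
  rw [Fin.prod_univ_eq_prod_range (fun i : ℕ => ((z : ℝ) +
    ((r + s + x + y - 1 - min (r + s) (r + s + x - 1 - i) : ℕ) : ℝ) - (i : ℕ)))]
  -- From here on `y` stands for the original value minus one, the number of full columns.
  obtain ⟨y, rfl⟩ : ∃ w, y = w + 1 := ⟨y - 1, by omega⟩
  rw [show r + s + x + (y + 1) - 1 = x + (r + s) + y by omega,
    show x + (y + 1) - 1 = y + x by omega, Finset.prod_range_add, Finset.prod_range_add]
  have h1 : ∏ i ∈ Finset.range x, ((z : ℝ) +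
      ((x + (r + s) + y - min (r + s) (r + s + x - 1 - i) : ℕ) : ℝ) - (i : ℕ)) =
      ∏ i ∈ Finset.range x, (((z + 1 + (y + i) : ℕ)) : ℝ) := by
    rw [← Finset.prod_range_reflect]
    refine Finset.prod_congr rfl fun i hi => ?_
    have hi := Finset.mem_range.mp hi
    rw [show x + (r + s) + y - min (r + s) (r + s + x - 1 - (x - 1 - i)) = x + y by omega,
      show x - 1 - i = x - (1 + i) by omega, Nat.cast_sub (by omega)]
    push_cast
    ring
  have h2 : ∏ i ∈ Finset.range (r + s), ((z : ℝ) +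
      ((x + (r + s) + y - min (r + s) (r + s + x - 1 - (x + i)) : ℕ) : ℝ) - ((x + i : ℕ) : ℝ)) =
      ((z : ℝ) + (y + 1 : ℕ)) ^ (r + s) := by
    rw [← Finset.card_range (r + s), ← Finset.prod_const, Finset.card_range]
    refine Finset.prod_congr rfl fun i hi => ?_
    have hi := Finset.mem_range.mp hi
    rw [show x + (r + s) + y - min (r + s) (r + s + x - 1 - (x + i)) = x + y + i + 1 by omega]
    push_cast
    ring
  have h3 : ∏ i ∈ Finset.range y, ((z : ℝ) +
      ((x + (r + s) + y - min (r + s) (r + s + x - 1 - (x + (r + s) + i)) : ℕ) : ℝ) -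
        ((x + (r + s) + i : ℕ) : ℝ)) =
      ∏ i ∈ Finset.range y, (((z + 1 + i : ℕ)) : ℝ) := by
    rw [← Finset.prod_range_reflect]
    refine Finset.prod_congr rfl fun i hi => ?_
    have hi := Finset.mem_range.mp hi
    rw [show x + (r + s) + y - min (r + s) (r + s + x - 1 - (x + (r + s) + (y - 1 - i))) =
      x + (r + s) + y by omega, show y - 1 - i = y - (1 + i) by omega]
    push_cast [Nat.cast_sub (show 1 + i ≤ y by omega)]
    ring
  have h4 : (((y + x)! : ℕ) : ℝ) * ((z + (y + x)).choose (y + x) : ℕ) =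
      (∏ i ∈ Finset.range y, (((z + 1 + i : ℕ)) : ℝ)) *
        ∏ i ∈ Finset.range x, (((z + 1 + (y + i) : ℕ)) : ℝ) := by
    rw [← Finset.prod_range_add (fun i => (((z + 1 + i : ℕ)) : ℝ)), ← Nat.cast_prod,
      ← Nat.ascFactorial_eq_prod_range, Nat.ascFactorial_eq_factorial_mul_choose]
    push_cast
    ring
  rw [h1, h2, h3, mul_left_comm, h4]
  ring

theorem qHit_csPartition (r s x y : ℕ) (hx : 0 < x) (hy : 0 < y) :
    qHit 1 (csPartition r s x y) r = ((x + y - 1)! : ℝ) * carlitzScoville r s x y := by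
  rw [qHit, ← Polynomial.coeff_coe, coe_qHitPolynomial_one_eq_prod (csPartition_antitone r s x y),
    carlitzScoville_eq_eulerCoeff r s x y (by omega), eulerCoeff, ← PowerSeries.coeff_C_mul,
    mul_left_comm, show r + s + x + y - 1 + 1 = r + s + x + y by omega]
  congr 2
  ext z
  rw [PowerSeries.coeff_C_mul, PowerSeries.coeff_mk, PowerSeries.coeff_mk,
    prod_csPartition r s x y z hx hy]

/-! ## Dropping the balls of the configuration -/

/-- The starting site `l + y` has y - 1 occupied sites on its left and x - 1 on its right; r and s
count the target sites still missing on each side. A ball changes (r, y) to (r - 1, y + 1) or (s, x)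
to (s - 1, x + 1), as in `carlitzScoville_rec`, and (x + y)! = (x + y) (x + y - 1)! absorbs the exit
denominator. -/
theorem supportProb_replicate (k r s x y : ℕ) (l : ℤ) (hk : r + s = k) (hx : 0 < x)
    (hy : 0 < y) :
    ((x + y + k - 1)! : ℝ) * supportProb (Finset.Ioo (l - r) (l + y + x + s))
        (Finset.Ioo l (l + y + x)) (List.replicate k (l + y)) =
      ((x + y - 1)! : ℝ) * carlitzScoville r s x y := by
  induction k generalizing r s x y l with
  | zero =>
    obtain rfl : r = 0 := by omega
    obtain rfl : s = 0 := by omega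
    simp [supportProb_nil, carlitzScoville_zero_zero]
  | succ k ih =>
    set T := Finset.Ioo (l - r) (l + y + x + s) with hT
    have hleft : ((x + y + k)! : ℝ) *
        supportProb T (Finset.Ioo (l - 1) (l + y + x)) (List.replicate k (l + y)) =
        ((x + y)! : ℝ) * if r = 0 then 0 else carlitzScoville (r - 1) s x (y + 1) := by
      split_ifs with hr
      -- With r = 0 the target starts at `l + 1`, so an exit to the left fills the forbidden site
      -- `l`.
      · rw [supportProb_eq_zero, mul_zero, mul_zero]
        intro h
        have : l ∈ T := h (by simp only [Finset.mem_Ioo]; omega)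
        rw [hT, Finset.mem_Ioo] at this
        omega
      · have := ih (r - 1) s x (y + 1) (l - 1) (by omega) hx (by omega)
        rw [show x + (y + 1) + k - 1 = x + y + k by omega,
          show x + (y + 1) - 1 = x + y by omega,
          show l - 1 - ((r - 1 : ℕ) : ℤ) = l - r by omega,
          show l - 1 + ((y + 1 : ℕ) : ℤ) = l + y by push_cast; ring] at this
        exact this
    have hright : ((x + y + k)! : ℝ) *
        supportProb T (Finset.Ioo l (l + y + x + 1)) (List.replicate k (l + y)) =
        ((x + y)! : ℝ) * if s = 0 then 0 else carlitzScoville r (s - 1) (x + 1) y := by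
      split_ifs with hs
      · rw [supportProb_eq_zero, mul_zero, mul_zero]
        intro h
        have : l + y + x ∈ T := h (by simp only [Finset.mem_Ioo]; omega)
        rw [hT, Finset.mem_Ioo] at this
        omega
      · have := ih r (s - 1) (x + 1) y l (by omega) (by omega) hy
        rw [show x + 1 + y + k - 1 = x + y + k by omega,
          show x + 1 + y - 1 = x + y by omega,
          show l + y + ((x + 1 : ℕ) : ℤ) + ((s - 1 : ℕ) : ℤ) = l + y + x + s by omega,
          show l + y + ((x + 1 : ℕ) : ℤ) = l + y + x + 1 by push_cast; ring] at this
        exact this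
    have hexit := supportProb_Ioo_cons T (List.replicate k (l + y)) l x y hx hy
    have hfac : ((x + y)! : ℝ) = (x + y) * ((x + y - 1)! : ℝ) := by
      rw [← Nat.mul_factorial_pred (by omega : x + y ≠ 0)]
      push_cast
      ring
    have hpos : (x : ℝ) + y ≠ 0 := by positivity
    rw [List.replicate_succ, show x + y + (k + 1) - 1 = x + y + k by omega,
      carlitzScoville_rec r s x y (by omega)]
    apply mul_left_cancel₀ hpos
    rw [hfac] at hleft hright
    have e1 : (if r = 0 then 0 else (x : ℝ) * carlitzScoville (r - 1) s x (y + 1)) =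
        x * if r = 0 then 0 else carlitzScoville (r - 1) s x (y + 1) := by
      split_ifs <;> simp
    have e2 : (if s = 0 then 0 else (y : ℝ) * carlitzScoville r (s - 1) (x + 1) y) =
        y * if s = 0 then 0 else carlitzScoville r (s - 1) (x + 1) y := by
      split_ifs <;> simp
    rw [e1, e2]
    linear_combination ((x + y + k)! : ℝ) * hexit + x * hleft + y * hright

/-- The balls of the tuple `c` placed on the sites `a + 1, a + 2, …`. -/
def ballsFrom : ℤ → List ℕ → Multiset ℤ
  | _, [] => 0
  | a, c :: cs => Multiset.replicate c (a + 1) + ballsFrom (a + 1) cs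

/-- The recursive form, with a movable origin, is additive under concatenation of tuples. The
induction needs an arbitrary origin `a`. -/
theorem ballMultiset_eq_ballsFrom (c : List ℕ) : ballMultiset c = ballsFrom 0 c := by
  have h : ∀ (c : List ℕ) (a : ℤ), ∑ i : Fin c.length,
      Multiset.replicate (c.get i) (a + ((i : ℤ) + 1)) = ballsFrom a c := by
    intro c
    induction c with
    | nil => intro a; rfl
    | cons d c ih =>
      intro a
      rw [ballsFrom, ← ih (a + 1)]
      refine (Fin.sum_univ_succ (n := c.length) _).trans ?_
      congr 1
      refine Finset.sum_congr rfl fun i _ => ?_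
      congr 1
      rw [Fin.val_succ]
      push_cast
      ring
  rw [← h c 0, ballMultiset]
  simp

theorem ballsFrom_append (a : ℤ) (c d : List ℕ) :
    ballsFrom a (c ++ d) = ballsFrom a c + ballsFrom (a + c.length) d := by
  induction c generalizing a with
  | nil => simp [ballsFrom]
  | cons e c ih =>
    simp only [List.cons_append, ballsFrom, ih, List.length_cons]
    push_cast
    rw [add_assoc a 1, add_comm (1 : ℤ), ← add_assoc]

theorem ballsFrom_replicate_zero (a : ℤ) (k : ℕ) : ballsFrom a (List.replicate k 0) = 0 := by
  induction k generalizing a with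
  | zero => rfl
  | succ k ih => simp [List.replicate_succ, ballsFrom, ih]

theorem ballsFrom_replicate_one (a : ℤ) (k : ℕ) : ballsFrom a (List.replicate k 1) =
    (((List.range k).map fun i : ℕ => a + 1 + i : List ℤ) : Multiset ℤ) := by
  induction k with
  | zero => rfl
  | succ k ih =>
    rw [List.replicate_succ', ballsFrom_append, ih, List.range_succ, List.map_append,
      ← Multiset.coe_add]
    simp [ballsFrom]
    ring

/-- This exhibits the convenient order: one ball on each site of the interval, then the r + s
surplus balls of the site r + y. -/
theorem ballMultiset_csConfiguration (r s x y : ℕ) (hx : 0 < x) (hy : 0 < y) :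
    ballMultiset (csConfiguration r s x y) =
      (((List.range (x + y - 1)).map fun i : ℕ => (r : ℤ) + 1 + i) ++
        List.replicate (r + s) ((r : ℤ) + y) : List ℤ) := by
  have h1 : List.replicate (x + y - 1) 1 =
      List.replicate (y - 1) 1 ++ [1] ++ List.replicate (x - 1) 1 := by
    rw [show [1] = List.replicate 1 1 from rfl, ← List.replicate_add, ← List.replicate_add]
    congr 1
    omega
  have hsite : (r : ℤ) + ((y - 1 : ℕ) : ℤ) + 1 = r + y := by omega
  rw [← Multiset.coe_add, ← ballsFrom_replicate_one, h1, ballMultiset_eq_ballsFrom,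
    csConfiguration]
  simp only [ballsFrom_append, ballsFrom_replicate_zero, ballsFrom, List.length_append,
    List.length_replicate, List.length_cons, List.length_nil, Multiset.replicate_add,
    zero_add, add_zero, Multiset.coe_replicate]
  push_cast
  simp only [← add_assoc, hsite]
  abel

theorem length_csConfiguration (r s x y : ℕ) (hx : 0 < x) (hy : 0 < y) :
    (csConfiguration r s x y).length = r + s + x + y - 1 := by
  simp only [csConfiguration, List.length_append, List.length_replicate, List.length_cons,
    List.length_nil]
  omega

theorem isConnectedConfiguration_csConfiguration (r s x y : ℕ) (hx : 0 < x) (hy : 0 < y) :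
    IsConnectedConfiguration (csConfiguration r s x y) := by
  refine ⟨?_, r, s, List.replicate (y - 1) 1 ++ [r + s + 1] ++ List.replicate (x - 1) 1, by simp,
    ?_, by simp [csConfiguration]⟩
  · rw [IsConfiguration, length_csConfiguration r s x y hx hy, csConfiguration]
    simp only [List.sum_append, List.sum_replicate, List.sum_cons, List.sum_nil, smul_eq_mul]
    omega
  · intro g hg
    simp only [List.mem_append, List.mem_replicate, List.mem_singleton] at hg
    omega

theorem hasContent_leftToRightOrder (c : List ℕ) : HasContent (leftToRightOrder c) c :=
  Multiset.sort_eq _ _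

/-- The probability of filling a given set of sites does not depend on the order of the balls. -/
theorem finalSupportProb_one_eq_of_hasContent {c : List ℕ} {u v : List ℤ} (hu : HasContent u c)
    (hv : HasContent v c) (T : Finset ℤ) : finalSupportProb 1 u T = finalSupportProb 1 v T := by
  refine (ENNReal.toReal_eq_toReal_iff' (iSup_dropLaw_ne_top 1 T (∅, u))
    (iSup_dropLaw_ne_top 1 T (∅, v))).mp ?_
  exact supportProb_perm T ∅ (Multiset.coe_eq_coe.mp (Eq.trans hu (Eq.symm hv)))

/-- Order independence allows the order just described. The single balls stop at once and fill the
interval, which is the starting position of `supportProb_replicate` with `l = r`; the total number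
of balls is n, so [n]! = n! is the factorial on its left side. -/
theorem remixedEulerian_one_csConfiguration (r s x y : ℕ) (hx : 0 < x) (hy : 0 < y) :
    remixedEulerian 1 (csConfiguration r s x y) =
      ((x + y - 1)! : ℝ) * carlitzScoville r s x y := by
  rw [remixedEulerian, finalSupportProb_one_eq_of_hasContent (hasContent_leftToRightOrder _)
    (ballMultiset_csConfiguration r s x y hx hy).symm]
  change _ * supportProb _ ∅ _ = _
  rw [supportProb_append, length_csConfiguration r s x y hx hy, NNReal.coe_one, qFactorial_one,
    ← supportProb_replicate (r + s) r s x y r rfl hx hy]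
  · congr 2
    · congr 1
      omega
    · ext z
      simp only [Finset.mem_Icc, Finset.mem_Ioo]
      omega
    · ext z
      simp only [Finset.mem_union, Finset.notMem_empty, false_or, List.mem_toFinset,
        List.mem_map, List.mem_range, Finset.mem_Ioo]
      constructor
      · rintro ⟨i, hi, rfl⟩
        omega
      · intro hz
        exact ⟨(z - r - 1).toNat, by omega, by omega⟩
  · exact List.nodup_range.map fun i j hij => by simpa using hij
  · simp

end

/-! ### The theorem -/

theorem mainTheorem4 (r s x y : ℕ) (hx : 0 < x) (hy : 0 < y) :
    IsConnectedConfiguration (csConfiguration r s x y) ∧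
    (∀ u : List ℤ, HasContent u (csConfiguration r s x y) →
      finalSupportProb 1 u (Finset.Icc 1 ((csConfiguration r s x y).length : ℤ)) =
        finalSupportProb 1 (leftToRightOrder (csConfiguration r s x y))
          (Finset.Icc 1 ((csConfiguration r s x y).length : ℤ))) ∧
    carlitzScoville r s x y =
      1 / ((x + y - 1).factorial : ℝ) * remixedEulerian 1 (csConfiguration r s x y) ∧
    ∃ lam : Fin (r + s + x + y - 1) → ℕ,
      Antitone lam ∧ (∀ k, lam k ≤ r + s + x + y - 1) ∧
      (∀ k, lam k = min (r + s) (r + s + x - 1 - (k : ℕ))) ∧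
      carlitzScoville r s x y = 1 / ((x + y - 1).factorial : ℝ) * qHit 1 lam r := by
  have hfac : ((x + y - 1)! : ℝ) ≠ 0 := by positivity
  refine ⟨isConnectedConfiguration_csConfiguration r s x y hx hy, fun u hu =>
    finalSupportProb_one_eq_of_hasContent hu (hasContent_leftToRightOrder _) _, ?_,
    csPartition r s x y, csPartition_antitone r s x y, fun k => ?_, fun k => rfl, ?_⟩
  · rw [remixedEulerian_one_csConfiguration r s x y hx hy, one_div, inv_mul_cancel_left₀ hfac]
  · simp only [csPartition]
    omega
  · rw [qHit_csPartition r s x y hx hy, one_div, inv_mul_cancel_left₀ hfac]
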